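/- **Theorem 2.8** (First S-fraction for permutations, $p,q$-generalization). For $\sigma\in\mathfrak S_n$ (a permutation of $[n]=\{1,\dots,n\}$): - $i\in[n]$ is a *record* if $\sigma(j)<\sigma(i)$ for all $j<i$, an *antirecord* if $\sigma(j)>\sigma(i)$ for all $j>i$, and an *excedance* if $\sigma(i)>i$. Let $\mathrm{arec}(\sigma)$, $\mathrm{erec}(\sigma)$, $\mathrm{exc}(\sigma)$ be the numbers of antirecords, of records that are not antirecords, and of excedances, respectively. - $\mathrm{ucross}(\sigma)$, $\mathrm{lcross}(\sigma)$, $\mathrm{unest}(\sigma)$, $\mathrm{lnest}(\sigma)$ are the numbers of quadruplets $i<j<k<l$ in $[n]$ such that, respectively, $k=\sigma(i),\ l=\sigma(j)$; $i=\sigma(k),\ j=\sigma(l)$; $l=\sigma(i),\ k=\sigma(j)$; $i=\sigma(l),\ j=\sigma(k)$. - $\mathrm{ljoin}(\sigma)$ is the number of triplets $i<j<l$ with $i=\sigma(j)$, $j=\sigma(l)$; $\mathrm{psnest}(\sigma)$ is the number of triplets $i<j<l$ with $l=\sigma(i)$, $j=\sigma(j)$ (equivalently, with $i=\sigma(l)$,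 $j=\sigma(j)$). Let $x,y,u,v,p_+,p_-,q_+,q_-$ be elements of an arbitrary commutative ring $R$ (in particular, they may be the indeterminates of $R=\mathbb Z[x,y,u,v,p_+,p_-,q_+,q_-]$), and put $$ P_n(x,y,u,v,p_+,p_-,q_+,q_-)=\sum_{\sigma\in\mathfrak S_n} x^{\mathrm{arec}(\sigma)}\,y^{\mathrm{erec}(\sigma)}\,u^{n-\mathrm{exc}(\sigma)-\mathrm{arec}(\sigma)}\,v^{\mathrm{exc}(\sigma)-\mathrm{erec}(\sigma)}\; p_+^{\mathrm{ucross}(\sigma)}\,p_-^{\mathrm{lcross}(\sigma)+\mathrm{ljoin}(\sigma)}\,q_+^{\mathrm{unest}(\sigma)}\,q_-^{\mathrm{lnest}(\sigma)+\mathrm{psnest}(\sigma)} . $$ (All exponents are nonnegative.) Write $[n]_{p,q}=\sum_{j=0}^{n-1}p^jq^{n-1-j}$. Then, as formal power series in $t$ over $R$, $$ \sum_{n=0}^\infty P_n(x,y,u,v,p_+,p_-,q_+,q_-)\,t^n =\cfrac{1}{1-\cfrac{\alpha_1t}{1-\cfrac{\alpha_2t}{1-\cdots}}}\,, $$ where,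 for all $k\ge1$, $$ \alpha_{2k-1}=p_-^{k-1}x+q_-\,[k-1]_{p_-,q_-}\,u,\qquad \alpha_{2k}=p_+^{k-1}y+q_+\,[k-1]_{p_+,q_+}\,v . $$ The infinite continued fraction denotes the coefficientwise limit of its truncations. -/

import Mathlib

namespace PermStat

variable {n : ℕ}

/-- The index `i` is a record (left-to-right maximum) of `σ`. -/
abbrev IsRecord (σ : Equiv.Perm (Fin n)) (i : Fin n) : Prop := ∀ j, j < i → σ j < σ i

/-- The index `i` is an antirecord (right-to-left minimum) of `σ`. -/
abbrev IsAntirecord (σ : Equiv.Perm (Fin n)) (i : Fin n) : Prop := ∀ j, i < j → σ i < σ j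

/-- Number of antirecords. -/
def arec (σ : Equiv.Perm (Fin n)) : ℕ :=
  (Finset.univ.filter fun i : Fin n => IsAntirecord σ i).card

/-- Number of exclusive records, i.e. records that are not antirecords. -/
def erec (σ : Equiv.Perm (Fin n)) : ℕ :=
  (Finset.univ.filter fun i : Fin n => IsRecord σ i ∧ ¬ IsAntirecord σ i).card

/-- Number of excedances. -/
def exc (σ : Equiv.Perm (Fin n)) : ℕ :=
  (Finset.univ.filter fun i : Fin n => i < σ i).card

/-- Number of upper crossings: quadruplets `i < j < k < l` with `k = σ i`, `l = σ j`. -/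
def ucross (σ : Equiv.Perm (Fin n)) : ℕ :=
  (Finset.univ.filter fun (i, j, k, l) =>
    (i : Fin n) < (j : Fin n) ∧ j < (k : Fin n) ∧ k < (l : Fin n) ∧ k = σ i ∧ l = σ j).card

/-- Number of lower crossings: quadruplets `i < j < k < l` with `i = σ k`, `j = σ l`. -/
def lcross (σ : Equiv.Perm (Fin n)) : ℕ :=
  (Finset.univ.filter fun (i, j, k, l) =>
    (i : Fin n) < (j : Fin n) ∧ j < (k : Fin n) ∧ k < (l : Fin n) ∧ i = σ k ∧ j = σ l).card

/-- Number of upper nestings: quadruplets `i < j < k < l` with `l = σ i`, `k = σ j`. -/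
def unest (σ : Equiv.Perm (Fin n)) : ℕ :=
  (Finset.univ.filter fun (i, j, k, l) =>
    (i : Fin n) < (j : Fin n) ∧ j < (k : Fin n) ∧ k < (l : Fin n) ∧ l = σ i ∧ k = σ j).card

/-- Number of lower nestings: quadruplets `i < j < k < l` with `i = σ l`, `j = σ k`. -/
def lnest (σ : Equiv.Perm (Fin n)) : ℕ :=
  (Finset.univ.filter fun (i, j, k, l) =>
    (i : Fin n) < (j : Fin n) ∧ j < (k : Fin n) ∧ k < (l : Fin n) ∧ i = σ l ∧ j = σ k).card

/-- Number of lower joinings: triplets `i < j < l` with `i = σ j`, `j = σ l`. -/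
def ljoin (σ : Equiv.Perm (Fin n)) : ℕ :=
  (Finset.univ.filter fun (i, j, l) =>
    (i : Fin n) < (j : Fin n) ∧ j < (l : Fin n) ∧ i = σ j ∧ j = σ l).card

/-- Number of upper pseudo-nestings: triplets `i < j < l` with `l = σ i`, `j = σ j`. -/
def upsnest (σ : Equiv.Perm (Fin n)) : ℕ :=
  (Finset.univ.filter fun (i, j, l) =>
    (i : Fin n) < (j : Fin n) ∧ j < (l : Fin n) ∧ l = σ i ∧ j = σ j).card

/-- Number of lower pseudo-nestings: triplets `i < j < l` with `i = σ l`, `j = σ j`. -/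
def lpsnest (σ : Equiv.Perm (Fin n)) : ℕ :=
  (Finset.univ.filter fun (i, j, l) =>
    (i : Fin n) < (j : Fin n) ∧ j < (l : Fin n) ∧ i = σ l ∧ j = σ j).card

/-- The common value `psnest = upsnest = lpsnest` (see `psnest_eq_lpsnest`). -/
def psnest (σ : Equiv.Perm (Fin n)) : ℕ := upsnest σ

theorem psnest_eq_lpsnest (σ : Equiv.Perm (Fin n)) : psnest σ = lpsnest σ := by
  have hU : upsnest σ = ∑ j : Fin n, (Finset.univ.filter fun i : Fin n =>
      i < j ∧ j < σ i ∧ j = σ j).card := by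
    rw [← Finset.card_sigma]
    refine Finset.card_bij' (fun a _ => ⟨a.2.1, a.1⟩) (fun b _ => (b.2, b.1, σ b.2)) ?_ ?_ ?_ ?_
    · rintro ⟨i, j, l⟩ h; simp at h ⊢; grind
    · rintro ⟨j, i⟩ h; simp at h ⊢; grind
    · rintro ⟨i, j, l⟩ h; simp at h ⊢; grind
    · rintro ⟨j, i⟩ h; simp
  have hL : lpsnest σ = ∑ j : Fin n, (Finset.univ.filter fun i : Fin n =>
      j < i ∧ σ i < j ∧ j = σ j).card := by
    rw [← Finset.card_sigma]
    refine Finset.card_bij' (fun a _ => ⟨a.2.1, a.2.2⟩) (fun b _ => (σ b.2, b.1, b.2)) ?_ ?_ ?_ ?_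
    · rintro ⟨i, j, l⟩ h; simp at h ⊢; grind
    · rintro ⟨j, i⟩ h; simp at h ⊢; grind
    · rintro ⟨i, j, l⟩ h; simp at h ⊢; grind
    · rintro ⟨j, i⟩ h; simp
  rw [psnest, hU, hL]
  refine Finset.sum_congr rfl fun j _ => ?_
  by_cases hj : j = σ j
  swap
  · simp [hj]
  have hA := Finset.card_filter_add_card_filter_not (s := Finset.univ.filter fun i : Fin n => i < j)
    (fun i => σ i < j)
  have hB := Finset.card_filter_add_card_filter_not
    (s := Finset.univ.filter fun i : Fin n => σ i < j) (fun i => i < j)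
  have hC : (Finset.univ.filter fun i : Fin n => σ i < j).card
      = (Finset.univ.filter fun i : Fin n => i < j).card :=
    Finset.card_bij (fun i _ => σ i) (by simp) (by simp) (fun b hb => ⟨σ.symm b, by simpa using hb⟩)
  simp only [Finset.filter_filter] at hA hB
  have e1 : (Finset.univ.filter fun i : Fin n => i < j ∧ ¬ σ i < j)
      = Finset.univ.filter fun i : Fin n => i < j ∧ j < σ i ∧ j = σ j := by
    ext i
    have : σ i = j → i = j := fun h => σ.injective (h.trans hj)
    simp; grind
  have e2 : (Finset.univ.filter fun i : Fin n => σ i < j ∧ ¬ i < j)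
      = Finset.univ.filter fun i : Fin n => j < i ∧ σ i < j ∧ j = σ j := by
    ext i
    simp; grind
  have e3 : (Finset.univ.filter fun i : Fin n => σ i < j ∧ i < j)
      = Finset.univ.filter fun i : Fin n => i < j ∧ σ i < j := by
    ext i; simp [and_comm]
  rw [e1] at hA
  rw [e2, e3] at hB
  omega

theorem IsRecord.le {σ : Equiv.Perm (Fin n)} {i : Fin n} (h : IsRecord σ i) : i ≤ σ i := by
  have : (Finset.Iic i).card ≤ (Finset.Iic (σ i)).card :=
    Finset.card_le_card_of_injOn σ
      (fun j hj => by
        simp only [Finset.coe_Iic, Set.mem_Iic] at hj ⊢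
        rcases hj.lt_or_eq with h1 | rfl
        · exact (h j h1).le
        · exact le_rfl) σ.injective.injOn
  simp only [Fin.card_Iic] at this
  exact Fin.le_def.2 (by omega)

theorem IsAntirecord.le {σ : Equiv.Perm (Fin n)} {i : Fin n} (h : IsAntirecord σ i) :
    σ i ≤ i := by
  have : (Finset.Ici i).card ≤ (Finset.Ici (σ i)).card :=
    Finset.card_le_card_of_injOn σ
      (fun j hj => by
        simp only [Finset.coe_Ici, Set.mem_Ici] at hj ⊢
        rcases hj.lt_or_eq with h1 | rfl
        · exact (h j h1).le
        · exact le_rfl) σ.injective.injOn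
  simp only [Fin.card_Ici] at this
  have := i.isLt
  exact Fin.le_def.2 (by omega)

/-- No truncation occurs in the exponent `n - exc σ - arec σ`. -/
theorem exc_add_arec_le (σ : Equiv.Perm (Fin n)) : exc σ + arec σ ≤ n := by
  have hd : Disjoint (Finset.univ.filter fun i : Fin n => i < σ i)
      (Finset.univ.filter fun i : Fin n => IsAntirecord σ i) := by
    rw [Finset.disjoint_filter]
    exact fun i _ h1 h2 => absurd (IsAntirecord.le h2) (not_le.2 h1)
  rw [exc, arec, ← Finset.card_union_of_disjoint hd]
  exact (Finset.card_le_univ _).trans (by simp)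

/-- No truncation occurs in the exponent `exc σ - erec σ`. -/
theorem erec_le_exc (σ : Equiv.Perm (Fin n)) : erec σ ≤ exc σ := by
  refine Finset.card_le_card fun i hi => ?_
  simp only [Finset.mem_filter, Finset.mem_univ, true_and] at hi ⊢
  refine lt_of_le_of_ne (IsRecord.le hi.1) fun h => hi.2 fun j hj => ?_
  by_contra hc
  -- the records up to `i` fill `Iic i`, so no later value can be smaller
  have hm : Set.MapsTo σ (insert j (Finset.Iic i) : Finset (Fin n)) (Finset.Iic i : Finset (Fin n)) := by
    intro k hk
    simp only [Finset.coe_insert, Finset.coe_Iic, Set.mem_insert_iff, Set.mem_Iic] at hk ⊢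
    rcases hk with rfl | hk
    · exact (not_lt.1 hc).trans h.ge
    · rcases hk.lt_or_eq with h1 | rfl
      · exact (hi.1 k h1).le.trans h.ge
      · exact h.ge
  have := Finset.card_le_card_of_injOn σ hm σ.injective.injOn
  rw [Finset.card_insert_of_notMem (by simpa using hj)] at this
  omega

/-- The polynomial `P_n` in eight variables (`pp`, `pm`, `qp`, `qm` are `p₊`, `p₋`, `q₊`, `q₋`),
as an element of any commutative ring from which the variables are taken. -/
def P {R : Type*} [CommRing R] (n : ℕ) (x y u v pp pm qp qm : R) : R :=
  ∑ σ : Equiv.Perm (Fin n),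
    x ^ arec σ * y ^ erec σ * u ^ (n - exc σ - arec σ) * v ^ (exc σ - erec σ) *
      (pp ^ ucross σ * pm ^ (lcross σ + ljoin σ) * qp ^ unest σ * qm ^ (lnest σ + psnest σ))

/-- `[n]_{p,q} = (p^n - q^n)/(p - q)`, as a polynomial in `p` and `q`. -/
def pqInt {R : Type*} [CommRing R] (n : ℕ) (p q : R) : R :=
  ∑ j ∈ Finset.range n, p ^ j * q ^ (n - 1 - j)

end PermStat

namespace SFrac

variable {R : Type*} [CommRing R]

/-- The finite continued fraction `1/(1 - α₁ t/(1 - α₂ t/(⋯/(1 - α_N t))))` as a formal power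
series in `t`; it is `1` for `N = 0`, and `α 0` is not used. -/
noncomputable def convergent (α : ℕ → R) : ℕ → PowerSeries R
  | 0 => 1
  | N + 1 => PowerSeries.invOfUnit
      (1 - PowerSeries.C (α 1) * PowerSeries.X * convergent (fun k => α (k + 1)) N) 1

/-- The infinite S-fraction `1/(1 - α₁ t/(1 - α₂ t/(1 - ⋯)))`: the coefficientwise (`t`-adic) limit
of its convergents, whose coefficient of `t^n` is constant from the `n`-th convergent on
(see `coeff_convergent`). -/
noncomputable def sFraction (α : ℕ → R) : PowerSeries R :=
  PowerSeries.mk fun n => PowerSeries.coeff n (convergent α n)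

theorem convergent_succ_mul (α : ℕ → R) (N : ℕ) :
    (1 - PowerSeries.C (α 1) * PowerSeries.X * convergent (fun k => α (k + 1)) N) *
      convergent α (N + 1) = 1 := by
  rw [convergent]
  exact PowerSeries.mul_invOfUnit _ _ (by simp)

theorem coeff_convergent_succ (α : ℕ → R) (n N : ℕ) (h : n ≤ N) :
    PowerSeries.coeff n (convergent α (N + 1)) = PowerSeries.coeff n (convergent α N) := by
  suffices H : ∀ N (α : ℕ → R), (PowerSeries.X : PowerSeries R) ^ (N + 1) ∣
      convergent α (N + 1) - convergent α N by
    have := (PowerSeries.X_pow_dvd_iff.1 (H N α)) n (by omega)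
    simpa [sub_eq_zero] using this
  intro N
  induction N with
  | zero =>
    intro α
    have h := convergent_succ_mul α 0
    refine ⟨PowerSeries.C (α 1) * convergent (fun k => α (k + 1)) 0 * convergent α 1, ?_⟩
    have h0 : convergent α 0 = 1 := rfl
    simp only [zero_add, pow_one] at h ⊢
    linear_combination h - h0
  | succ N ih =>
    intro α
    obtain ⟨d, hd⟩ := ih (fun k => α (k + 1))
    have h1 := convergent_succ_mul α N
    have h2 := convergent_succ_mul α (N + 1)
    refine ⟨PowerSeries.C (α 1) * d * convergent α (N + 1) * convergent α (N + 2), ?_⟩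
    linear_combination convergent α (N + 1) * h2 - convergent α (N + 2) * h1 +
      PowerSeries.C (α 1) * PowerSeries.X * convergent α (N + 1) * convergent α (N + 2) * hd

/-- The convergents converge to the S-fraction, with explicit stabilization. -/
theorem coeff_convergent (α : ℕ → R) (n N : ℕ) (h : n ≤ N) :
    PowerSeries.coeff n (convergent α N) = PowerSeries.coeff n (sFraction α) := by
  induction N, h using Nat.le_induction with
  | base => simp [sFraction]
  | succ N hN ih => rw [coeff_convergent_succ α n N hN, ih]

end SFrac

/-! Represent position `i` of `σ` by the point `2 * i + 1`, value `i` by the point `2 * i`, and join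
each position to its value. This identifies permutations of `Fin n` with perfect matchings of `range
(2 * n)` whose arcs join points of opposite parity (`exists_arcs_eq`, `arcs_injective`). Excedances
give the arcs that close at an even point; all other indices, fixed points included, give those that
close at an odd point.

Scan the points from left to right. When an arc closes at `b`, its opener is one of the still
unmatched points of the other parity. The candidates to the left of the opener belong to arcs that
nest over the new arc, those to its right to arcs that cross or join it (`arcWeight_arcs`). An arc
with nothing nested over it is a record or an antirecord. Hence the weight of `σ` is a product of
arc weights, each depending only on the rank of the opener among the candidates
(`prod_localWeight`).

Each arc uses one point of each parity, so the number of candidates depends only on the numbers of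
points and arcs seen so far (`card_partners_add`), that is, on the number of unmatched points, which
is the height of a Dyck path. Summing over openers at a closer reached from height `h` therefore
gives a constant `α h`, and the total weights obey the recurrence of Dyck prefixes with falls
weighted by `α` (`total_succ`). The S-fraction generates such paths (`eq_coeff_prefixSeries`), and
`sum_pow_mul_ite` evaluates `α`. -/

namespace SFrac

/-! ### S-fractions and weighted Dyck prefixes -/

variable {R : Type*} [CommRing R]

/-- The functional equation of the infinite S-fraction. -/
theorem sFraction_eq (α : ℕ → R) :
    sFraction α = 1 + PowerSeries.C (α 1) * PowerSeries.X *
      (sFraction (fun k => α (k + 1)) * sFraction α) := by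
  ext n
  have h := congrArg (PowerSeries.coeff n) (convergent_succ_mul α n)
  rw [sub_mul, one_mul, map_sub, sub_eq_iff_eq_add, mul_assoc] at h
  -- The equation of convergent `n + 1` involves convergent `n` of the shifted sequence. The factor
  -- `X` leaves only coefficients of index below `n`, where both convergents have stabilized.
  rw [← coeff_convergent α n (n + 1) (by omega), h, map_add]
  congr 1
  rw [mul_assoc, mul_assoc, PowerSeries.coeff_C_mul, PowerSeries.coeff_C_mul]
  congr 1
  cases n with
  | zero => simp
  | succ n =>
    rw [PowerSeries.coeff_succ_X_mul, PowerSeries.coeff_succ_X_mul, PowerSeries.coeff_mul,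
      PowerSeries.coeff_mul]
    refine Finset.sum_congr rfl fun p hp => ?_
    have := Finset.HasAntidiagonal.mem_antidiagonal.1 hp
    rw [coeff_convergent _ p.1 _ (by omega), coeff_convergent _ p.2 _ (by omega)]

/-- The product of the S-fractions obtained from `α` by shifts by `0, …, h`: the generating
function of weighted Dyck prefixes ending at height `h`. -/
noncomputable def prefixSeries (α : ℕ → R) (h : ℕ) : PowerSeries R :=
  ∏ i ∈ Finset.range (h + 1), sFraction (fun k => α (k + i))

theorem prefixSeries_zero (α : ℕ → R) :
    prefixSeries α 0 = 1 + PowerSeries.C (α 1) * PowerSeries.X * prefixSeries α 1 := by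
  simp only [prefixSeries, Finset.prod_range_succ, Finset.prod_range_zero, one_mul, add_zero]
  rw [mul_comm (sFraction fun k => α k)]
  exact sFraction_eq α

/-- The last step of a prefix ending at height `h + 1` is a rise from `h` or a weighted fall from `h
+ 2`. Algebraically, this is the functional equation of the S-fraction shifted by `h + 1`,
multiplied by `prefixSeries α h`. -/
theorem prefixSeries_succ (α : ℕ → R) (h : ℕ) :
    prefixSeries α (h + 1) = prefixSeries α h +
      PowerSeries.C (α (h + 2)) * PowerSeries.X * prefixSeries α (h + 2) := by
  have e := sFraction_eq (fun k => α (k + (h + 1)))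
  have e1 : (fun k => α (k + 1 + (h + 1))) = fun k => α (k + (h + 2)) := by
    funext k; congr 1; ring
  have e2 : 1 + (h + 1) = h + 2 := by ring
  rw [e1, e2] at e
  have s1 : prefixSeries α (h + 1) = prefixSeries α h * sFraction (fun k => α (k + (h + 1))) :=
    Finset.prod_range_succ _ _
  have s2 : prefixSeries α (h + 2) = prefixSeries α (h + 1) * sFraction (fun k => α (k + (h + 2))) :=
    Finset.prod_range_succ _ _
  rw [s2, s1]
  linear_combination prefixSeries α h * e

/-- An array satisfying the recurrence of Dyck prefixes (`N` steps, `m` of them down) with down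
steps from height `h` weighted by `α h` is given by the coefficients of `prefixSeries`. -/
theorem eq_coeff_prefixSeries (α : ℕ → R) (U : ℕ → ℕ → R) (h0 : ∀ N, U N 0 = 1)
    (hs : ∀ N m, 2 * m + 1 ≤ N → U (N + 1) (m + 1) = U N (m + 1) + α (N - 2 * m) * U N m)
    (hz : ∀ m, U (2 * m + 1) (m + 1) = 0) (m h : ℕ) :
    U (h + 2 * m) m = PowerSeries.coeff m (prefixSeries α h) := by
  induction m generalizing h with
  | zero =>
    rw [h0]
    induction h with
    | zero => rw [prefixSeries_zero, mul_assoc, map_add, PowerSeries.coeff_C_mul]; simp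
    | succ h ih => rw [prefixSeries_succ, mul_assoc, map_add, PowerSeries.coeff_C_mul, ← ih]; simp
  | succ m ih =>
    induction h with
    | zero =>
      -- Height `0` is reached only by a fall from height `1`: the other term of the recurrence sits
      -- at height `-1` and vanishes by `hz`.
      rw [prefixSeries_zero, mul_assoc, map_add, PowerSeries.coeff_C_mul,
        PowerSeries.coeff_succ_X_mul, ← ih, show 0 + 2 * (m + 1) = 2 * m + 1 + 1 by ring,
        hs _ _ le_rfl, hz, show 2 * m + 1 - 2 * m = 1 by omega, add_comm 1 (2 * m),
        PowerSeries.coeff_one, if_neg (by omega)]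
    | succ h ihh =>
      rw [prefixSeries_succ, mul_assoc, map_add, PowerSeries.coeff_C_mul,
        PowerSeries.coeff_succ_X_mul, ← ih, ← ihh,
        show h + 1 + 2 * (m + 1) = h + 2 * (m + 1) + 1 by ring, hs _ _ (by omega),
        show h + 2 * (m + 1) - 2 * m = h + 2 by omega,
        show h + 2 * (m + 1) = h + 2 + 2 * m by ring]

end SFrac

/-! ### Parity matchings built by scanning the points -/

namespace ParityMatching

open Finset

/-- A partial matching of `range N` by arcs whose endpoints have opposite parities. -/
structure IsPartial (N : ℕ) (M : Finset (ℕ × ℕ)) : Prop where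
  lt : ∀ p ∈ M, p.1 < p.2
  lt_bound : ∀ p ∈ M, p.2 < N
  parity : ∀ p ∈ M, p.1 % 2 ≠ p.2 % 2
  eq_of_shared : ∀ p ∈ M, ∀ q ∈ M, p.1 = q.1 ∨ p.1 = q.2 ∨ p.2 = q.1 ∨ p.2 = q.2 → p = q

open Classical in
/-- The finite set of partial matchings of `range N` with `m` arcs. -/
noncomputable def partials (N m : ℕ) : Finset (Finset (ℕ × ℕ)) :=
  (range N ×ˢ range N).powerset.filter fun M => IsPartial N M ∧ M.card = m

theorem mem_partials {N m : ℕ} {M : Finset (ℕ × ℕ)} :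
    M ∈ partials N m ↔ IsPartial N M ∧ M.card = m := by
  simp only [partials, mem_filter, mem_powerset, and_iff_right_iff_imp]
  rintro ⟨h, -⟩ p hp
  have h1 := h.lt p hp
  have h2 := h.lt_bound p hp
  simp only [mem_product, mem_range]
  omega

/-- The points of parity `r` below `b` that are on no arc closing before `b`. -/
def opens (M : Finset (ℕ × ℕ)) (b r : ℕ) : Finset ℕ :=
  (range b).filter fun c => c % 2 = r ∧ ∀ p ∈ M, p.2 < b → p.1 ≠ c ∧ p.2 ≠ c

/-- The points to which an arc closing at `b` may be attached. -/
def partners (M : Finset (ℕ × ℕ)) (b : ℕ) : Finset ℕ := opens M b ((b + 1) % 2)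

theorem mem_partners {M : Finset (ℕ × ℕ)} {b c : ℕ} : c ∈ partners M b ↔
    c < b ∧ c % 2 = (b + 1) % 2 ∧ ∀ p ∈ M, p.2 < b → p.1 ≠ c ∧ p.2 ≠ c := by
  simp [partners, opens]

/-- The endpoints of an arc have opposite parities, so every arc uses up exactly one point of parity
`r`. -/
theorem card_opens_add {N : ℕ} {M : Finset (ℕ × ℕ)} (h : IsPartial N M) {r : ℕ} (hr : r < 2) :
    (opens M N r).card + M.card = ((range N).filter fun c => c % 2 = r).card := by
  have himg : (M.image fun p => if p.1 % 2 = r then p.1 else p.2).card = M.card := by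
    refine card_image_of_injOn fun p hp q hq hpq => h.eq_of_shared p hp q hq ?_
    split_ifs at hpq <;> tauto
  rw [← himg, ← card_union_of_disjoint]
  · congr 1
    ext c
    simp only [opens, mem_union, mem_filter, mem_range, mem_image]
    constructor
    · rintro (⟨h1, h2, -⟩ | ⟨p, hp, rfl⟩)
      · exact ⟨h1, h2⟩
      · have h1 := h.lt p hp
        have h2 := h.lt_bound p hp
        have h3 := h.parity p hp
        split_ifs with h4
        · exact ⟨by omega, h4⟩
        · exact ⟨by omega, by omega⟩
    · rintro ⟨h1, h2⟩
      by_cases hc : ∃ p ∈ M, p.1 = c ∨ p.2 = c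
      · obtain ⟨p, hp, hpc⟩ := hc
        refine Or.inr ⟨p, hp, ?_⟩
        have h3 := h.parity p hp
        rcases hpc with rfl | rfl
        · rw [if_pos h2]
        · rw [if_neg (by omega)]
      · push Not at hc
        exact Or.inl ⟨h1, h2, fun p hp _ => hc p hp⟩
  · rw [disjoint_left]
    intro c hc hc'
    simp only [opens, mem_filter, mem_image] at hc hc'
    obtain ⟨p, hp, hpc⟩ := hc'
    have h1 := hc.2.2 p hp (h.lt_bound p hp)
    split_ifs at hpc
    · exact h1.1 hpc
    · exact h1.2 hpc

theorem card_filter_range_mod_two (N : ℕ) :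
    ((range N).filter fun c => c % 2 = 0).card = (N + 1) / 2 ∧
      ((range N).filter fun c => c % 2 = 1).card = N / 2 := by
  induction N with
  | zero => simp
  | succ N ih =>
    rw [range_add_one, filter_insert, filter_insert]
    rcases Nat.mod_two_eq_zero_or_one N with h | h
    · rw [if_pos h, if_neg (by omega), card_insert_of_notMem (by simp)]
      omega
    · rw [if_neg (by omega), if_pos h, card_insert_of_notMem (by simp)]
      omega

/-- The number of possible openers depends on `M` only through its number of arcs. This is why the
weight of a fall depends on the height alone. -/
theorem card_partners_add {N : ℕ} {M : Finset (ℕ × ℕ)} (h : IsPartial N M) :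
    (partners M N).card + M.card = N / 2 + N % 2 := by
  have h1 := card_opens_add h (Nat.mod_lt (N + 1) two_pos)
  have h2 := card_filter_range_mod_two N
  rw [partners, h1]
  rcases Nat.mod_two_eq_zero_or_one N with h3 | h3
  · rw [show (N + 1) % 2 = 1 by omega, h2.2]; omega
  · rw [show (N + 1) % 2 = 0 by omega, h2.1]; omega

theorem IsPartial.two_mul_card_le {N : ℕ} {M : Finset (ℕ × ℕ)} (h : IsPartial N M) :
    2 * M.card ≤ N := by
  have h1 := card_opens_add h (r := 1) (by omega)
  rw [(card_filter_range_mod_two N).2] at h1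
  omega

section Weight

variable {R : Type*} [CommRing R] (w : ℕ → ℕ → ℕ → R)

/-- The weight of an arc, in terms of the ranks of its opener among the possible ones. -/
def arcWeight (M : Finset (ℕ × ℕ)) (p : ℕ × ℕ) : R :=
  w (p.2 % 2) ((partners M p.2).filter (· < p.1)).card ((partners M p.2).filter (p.1 < ·)).card

/-- The weight of a partial matching. -/
def weight (M : Finset (ℕ × ℕ)) : R := ∏ p ∈ M, arcWeight w M p

/-- The total weight of the partial matchings of `range N` with `m` arcs. -/
noncomputable def total (N m : ℕ) : R := ∑ M ∈ partials N m, weight w M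

/-- Counting the smaller elements numbers `S` by `0, …, S.card - 1`. In the induction, a new maximum
adds one to the upper count of every other element and itself has nothing above it. -/
theorem sum_rank (S : Finset ℕ) (F : ℕ → ℕ → R) :
    ∑ a ∈ S, F (S.filter (· < a)).card (S.filter (a < ·)).card =
      ∑ r ∈ range S.card, F r (S.card - 1 - r) := by
  induction S using Finset.induction_on_max generalizing F with
  | empty => simp
  | insert m S hm ih =>
    have hmS : m ∉ S := fun h => lt_irrefl _ (hm m h)
    rw [sum_insert hmS, card_insert_of_notMem hmS, sum_range_succ, add_comm]
    congr 1
    -- The two truncated subtractions agree because `r < S.card`; the induction hypothesis is then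
    -- applied to `F` with its second argument shifted by one.
    · rw [← Finset.sum_congr rfl (g := fun r => F r (S.card + 1 - 1 - r))
        (s₁ := range S.card) (f := fun r => F r (S.card - 1 - r + 1)), ← ih fun r t => F r (t + 1)]
      · refine Finset.sum_congr rfl fun a ha => ?_
        rw [filter_insert, filter_insert, if_neg (hm a ha).not_gt, if_pos (hm a ha),
          card_insert_of_notMem (by simp [hmS])]
      · intro r hr
        have := mem_range.1 hr
        congr 1
        omega
    · rw [filter_insert, filter_insert, if_neg (lt_irrefl _), if_neg (lt_irrefl _),
        filter_true_of_mem hm, filter_false_of_mem fun a ha => (hm a ha).not_gt]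
      simp

theorem IsPartial.mono {N N' : ℕ} {M : Finset (ℕ × ℕ)} (h : IsPartial N M) (hN : N ≤ N') :
    IsPartial N' M :=
  ⟨h.lt, fun p hp => (h.lt_bound p hp).trans_le hN, h.parity, h.eq_of_shared⟩

theorem IsPartial.insert {N a : ℕ} {M : Finset (ℕ × ℕ)} (h : IsPartial N M)
    (ha : a ∈ partners M N) : IsPartial (N + 1) (insert (a, N) M) := by
  obtain ⟨h1, h2, h3⟩ := mem_partners.1 ha
  have key : ∀ p ∈ M, p.1 < p.2 ∧ p.2 < N ∧ p.1 ≠ a ∧ p.2 ≠ a := fun p hp =>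
    ⟨h.lt p hp, h.lt_bound p hp, h3 p hp (h.lt_bound p hp)⟩
  refine ⟨?_, ?_, ?_, ?_⟩
  · rintro p hp
    rcases mem_insert.1 hp with rfl | hp
    · exact h1
    · exact h.lt p hp
  · rintro p hp
    rcases mem_insert.1 hp with rfl | hp
    · exact Nat.lt_succ_self _
    · exact (h.lt_bound p hp).trans (Nat.lt_succ_self _)
  · rintro p hp
    rcases mem_insert.1 hp with rfl | hp
    · dsimp only; omega
    · exact h.parity p hp
  · intro p hp q hq hpq
    rcases mem_insert.1 hp with rfl | hp <;> rcases mem_insert.1 hq with rfl | hq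
    · rfl
    · have := key q hq; dsimp only at hpq; omega
    · have := key p hp; dsimp only at hpq; omega
    · exact h.eq_of_shared p hp q hq hpq

/-- Only arcs closing strictly before `b` matter to the candidates at `b`. Hence a later arc leaves
all earlier arc weights unchanged, and the weight is multiplicative along the scan. -/
theorem partners_insert_of_le {N a b : ℕ} (M : Finset (ℕ × ℕ)) (hb : b ≤ N) :
    partners (insert (a, N) M) b = partners M b := by
  ext c
  simp only [mem_partners, mem_insert, forall_eq_or_imp]
  constructor
  · rintro ⟨h1, h2, -, h3⟩; exact ⟨h1, h2, h3⟩
  · rintro ⟨h1, h2, h3⟩; exact ⟨h1, h2, fun h => absurd h (by omega), h3⟩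

theorem weight_insert {N a : ℕ} {M : Finset (ℕ × ℕ)} (h : IsPartial N M) :
    weight w (insert (a, N) M) = weight w M * w (N % 2)
      ((partners M N).filter (· < a)).card ((partners M N).filter (a < ·)).card := by
  have hn : (a, N) ∉ M := fun hp => lt_irrefl _ (h.lt_bound _ hp)
  rw [weight, prod_insert hn, mul_comm]
  congr 1
  · refine prod_congr rfl fun p hp => ?_
    rw [arcWeight, arcWeight, partners_insert_of_le M (h.lt_bound p hp).le]
  · rw [arcWeight, partners_insert_of_le M le_rfl]

theorem partials_succ_filter (N m : ℕ) :
    (partials (N + 1) m).filter (fun M => ∀ p ∈ M, p.2 ≠ N) = partials N m := by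
  ext M
  simp only [mem_filter, mem_partials]
  constructor
  · rintro ⟨⟨h, hm⟩, hN⟩
    refine ⟨⟨h.lt, fun p hp => ?_, h.parity, h.eq_of_shared⟩, hm⟩
    have h1 := h.lt_bound p hp
    have h2 := hN p hp
    omega
  · rintro ⟨h, hm⟩
    exact ⟨⟨h.mono N.le_succ, hm⟩, fun p hp => (h.lt_bound p hp).ne⟩

theorem IsPartial.erase {N a : ℕ} {M : Finset (ℕ × ℕ)} (h : IsPartial (N + 1) M)
    (ha : (a, N) ∈ M) : IsPartial N (M.erase (a, N)) ∧ a ∈ partners (M.erase (a, N)) N := by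
  refine ⟨⟨fun p hp => h.lt p (mem_of_mem_erase hp), fun p hp => ?_,
    fun p hp => h.parity p (mem_of_mem_erase hp), fun p hp q hq =>
      h.eq_of_shared p (mem_of_mem_erase hp) q (mem_of_mem_erase hq)⟩, mem_partners.2 ⟨?_, ?_, ?_⟩⟩
  · have h1 := h.lt_bound p (mem_of_mem_erase hp)
    have h2 : p.2 ≠ N := fun e => ne_of_mem_erase hp
      (h.eq_of_shared p (mem_of_mem_erase hp) _ ha (by simp [e]))
    omega
  · exact h.lt _ ha
  · have := h.parity _ ha; dsimp only at this; omega
  · intro p hp _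
    have h1 := fun e => ne_of_mem_erase hp (h.eq_of_shared p (mem_of_mem_erase hp) _ ha e)
    dsimp only at h1
    tauto

/-- Either no arc closes at the last point `N`, or deleting the arc that does gives a bijection with
pairs of a smaller matching and one of its `partners` at `N`. The sum over partners is then taken by
rank. -/
theorem total_succ (N m : ℕ) : total w (N + 1) (m + 1) = total w N (m + 1) +
    ∑ M ∈ partials N m, weight w M *
      ∑ r ∈ range (partners M N).card, w (N % 2) r ((partners M N).card - 1 - r) := by
  rw [total, ← sum_filter_add_sum_filter_not _ (fun M => ∀ p ∈ M, p.2 ≠ N), partials_succ_filter,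
    total]
  congr 1
  simp_rw [← sum_rank, mul_sum]
  rw [Finset.sum_sigma']
  symm
  refine Finset.sum_bij (fun x _ => insert (x.2, N) x.1) ?_ ?_ ?_ ?_
  · rintro ⟨M, a⟩ hx
    simp only [mem_sigma, mem_partials, mem_filter] at hx ⊢
    refine ⟨⟨hx.1.1.insert hx.2, ?_⟩, fun h => h _ (mem_insert_self _ _) rfl⟩
    rw [card_insert_of_notMem fun hp => lt_irrefl _ (hx.1.1.lt_bound _ hp), hx.1.2]
  · rintro ⟨M, a⟩ hx ⟨M', a'⟩ hx' he
    simp only [mem_sigma, mem_partials] at hx hx' he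
    have hn : ∀ c, (c, N) ∉ M := fun c hp => lt_irrefl _ (hx.1.1.lt_bound _ hp)
    have hn' : ∀ c, (c, N) ∉ M' := fun c hp => lt_irrefl _ (hx'.1.1.lt_bound _ hp)
    have ha : a = a' := by
      have h1 : (a, N) ∈ insert (a', N) M' := he ▸ mem_insert_self _ _
      simpa [hn'] using h1
    subst ha
    have : M = M' := by rw [← erase_insert (hn a), he, erase_insert (hn' a)]
    rw [this]
  · intro M hM
    simp only [mem_filter, mem_partials] at hM
    obtain ⟨⟨h, hm⟩, hN⟩ := hM
    push Not at hN
    obtain ⟨⟨a, b⟩, hp, hb⟩ := hN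
    dsimp only at hb
    subst hb
    refine ⟨⟨M.erase (a, b), a⟩, ?_, insert_erase hp⟩
    simp only [mem_sigma, mem_partials]
    exact ⟨⟨(h.erase hp).1, by rw [card_erase_of_mem hp, hm]; rfl⟩, (h.erase hp).2⟩
  · rintro ⟨M, a⟩ hx
    simp only [mem_sigma, mem_partials] at hx
    exact (weight_insert w hx.1.1).symm

theorem total_zero (N : ℕ) : total w N 0 = 1 := by
  have : partials N 0 = {∅} := by
    ext M
    simp only [mem_partials, card_eq_zero, mem_singleton, and_iff_right_iff_imp]
    rintro rfl
    exact ⟨by simp, by simp, by simp, by simp⟩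
  simp [total, this, weight]

theorem total_eq_zero (m : ℕ) : total w (2 * m + 1) (m + 1) = 0 := by
  refine sum_eq_zero fun M hM => ?_
  obtain ⟨h, hm⟩ := mem_partials.1 hM
  have := h.two_mul_card_le
  omega

/-- The generating function of perfect parity matchings is an S-fraction. -/
theorem total_eq_coeff_sFraction (α : ℕ → R)
    (hodd : ∀ k, α (2 * k + 1) = ∑ r ∈ range (k + 1), w 1 r (k - r))
    (heven : ∀ k, α (2 * k + 2) = ∑ r ∈ range (k + 1), w 0 r (k - r)) (n : ℕ) :
    total w (2 * n) n = PowerSeries.coeff n (SFrac.sFraction α) := by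
  have h := SFrac.eq_coeff_prefixSeries α (total w) (total_zero w) (fun N m hNm => ?_)
    (total_eq_zero w) n 0
  · simpa [SFrac.prefixSeries] using h
  · rw [total_succ, add_right_inj, mul_comm, total, sum_mul]
    refine sum_congr rfl fun M hM => ?_
    obtain ⟨h, hm⟩ := mem_partials.1 hM
    have hc := card_partners_add h
    -- There is a partner because `2 * m + 1 ≤ N`. By `hc`, the height `N - 2 * m` equals `2 * k +
    -- 2` for even `N` and `2 * k + 1` for odd `N`.
    obtain ⟨k, hk⟩ : ∃ k, (partners M N).card = k + 1 :=
      ⟨(partners M N).card - 1, by omega⟩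
    rw [hk, add_tsub_cancel_right]
    rcases Nat.mod_two_eq_zero_or_one N with h3 | h3
    · rw [h3, ← heven, show N - 2 * m = 2 * k + 2 by omega]
    · rw [h3, ← hodd, show N - 2 * m = 2 * k + 1 by omega]

end Weight

end ParityMatching

/-! ### Permutation statistics as sums over arcs -/

namespace PermStat

open Finset

variable {n : ℕ}

/-- Number of arcs of `σ` nesting over the arc at position `i`, with the convention that fixed
points are lower arcs. -/
def nestAt (σ : Equiv.Perm (Fin n)) (i : Fin n) : ℕ :=
  if i < σ i then (univ.filter fun j => j < i ∧ σ i < σ j).card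
  else (univ.filter fun l => i < l ∧ σ l < σ i).card

/-- Number of arcs of `σ` crossing or joining the arc at position `i` and closing after it. -/
def crossAt (σ : Equiv.Perm (Fin n)) (i : Fin n) : ℕ :=
  if i < σ i then (univ.filter fun j => i < j ∧ j < σ i ∧ σ i < σ j).card
  else (univ.filter fun l => i < l ∧ σ i < σ l ∧ σ l ≤ i).card

/-- Each upper crossing is counted once, at the arc of the pair that opens first. -/
theorem sum_crossAt_upper (σ : Equiv.Perm (Fin n)) :
    ∑ i with i < σ i, crossAt σ i = ucross σ := by
  have h : ∀ i ∈ univ.filter (fun i => i < σ i), crossAt σ i =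
      (univ.filter fun j => i < j ∧ j < σ i ∧ σ i < σ j).card :=
    fun i hi => if_pos (mem_filter.1 hi).2
  rw [sum_congr rfl h, ← card_sigma, ucross]
  refine card_bij' (fun b _ => (b.1, b.2, σ b.1, σ b.2)) (fun a _ => ⟨a.1, a.2.1⟩) ?_ ?_ ?_ ?_
  · rintro ⟨i, j⟩ h; simp at h ⊢; grind
  · rintro ⟨i, j, k, l⟩ h; simp at h ⊢; grind
  · rintro ⟨i, j⟩ h; simp
  · rintro ⟨i, j, k, l⟩ h; simp at h ⊢; grind

theorem sum_nestAt_upper (σ : Equiv.Perm (Fin n)) :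
    ∑ i with i < σ i, nestAt σ i = unest σ := by
  have h : ∀ i ∈ univ.filter (fun i => i < σ i), nestAt σ i =
      (univ.filter fun j => j < i ∧ σ i < σ j).card :=
    fun i hi => if_pos (mem_filter.1 hi).2
  rw [sum_congr rfl h, ← card_sigma, unest]
  refine card_bij' (fun b _ => (b.2, b.1, σ b.1, σ b.2)) (fun a _ => ⟨a.2.1, a.1⟩) ?_ ?_ ?_ ?_
  · rintro ⟨i, j⟩ h; simp at h ⊢; grind
  · rintro ⟨i, j, k, l⟩ h; simp at h ⊢; grind
  · rintro ⟨i, j⟩ h; simp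
  · rintro ⟨i, j, k, l⟩ h; simp at h ⊢; grind

/-- The non-strict inequality `σ l ≤ i` in `crossAt` separates into crossings (`σ l < i`) and
joinings (`σ l = i`). -/
theorem sum_crossAt_lower (σ : Equiv.Perm (Fin n)) :
    ∑ i with ¬ i < σ i, crossAt σ i = lcross σ + ljoin σ := by
  have hsplit : ∀ i ∈ univ.filter (fun i => ¬ i < σ i), crossAt σ i =
      (univ.filter fun l => i < l ∧ σ i < σ l ∧ σ l < i).card +
        (univ.filter fun l => i < l ∧ σ i < σ l ∧ σ l = i).card := by
    intro i hi
    rw [crossAt, if_neg (mem_filter.1 hi).2, ← card_union_of_disjoint]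
    · congr 1
      ext l
      simp only [mem_filter, mem_univ, true_and, mem_union, le_iff_lt_or_eq]
      tauto
    · rw [disjoint_filter]
      rintro l - h1 h2
      exact h1.2.2.ne h2.2.2
  rw [sum_congr rfl hsplit, sum_add_distrib, ← card_sigma, ← card_sigma, lcross, ljoin]
  congr 1
  · refine card_bij' (fun b _ => (σ b.1, σ b.2, b.1, b.2)) (fun a _ => ⟨a.2.2.1, a.2.2.2⟩)
      ?_ ?_ ?_ ?_
    · rintro ⟨i, j⟩ h; simp at h ⊢; grind
    · rintro ⟨i, j, k, l⟩ h; simp at h ⊢; grind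
    · rintro ⟨i, j⟩ h; simp
    · rintro ⟨i, j, k, l⟩ h; simp at h ⊢; grind
  · refine card_bij' (fun b _ => (σ b.1, b.1, b.2)) (fun a _ => ⟨a.2.1, a.2.2⟩) ?_ ?_ ?_ ?_
    · rintro ⟨i, j⟩ h; simp at h ⊢; grind
    · rintro ⟨i, j, l⟩ h; simp at h ⊢; grind
    · rintro ⟨i, j⟩ h; simp
    · rintro ⟨i, j, l⟩ h; simp at h ⊢; grind

/-- The inner arc is either a strict lower arc, giving a nesting, or a fixed point, giving a lower
pseudo-nesting; the latter are as numerous as the upper ones. -/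
theorem sum_nestAt_lower (σ : Equiv.Perm (Fin n)) :
    ∑ i with ¬ i < σ i, nestAt σ i = lnest σ + psnest σ := by
  have hsplit : ∀ i ∈ univ.filter (fun i => ¬ i < σ i), nestAt σ i =
      (univ.filter fun l => i < l ∧ σ l < σ i ∧ σ i < i).card +
        (univ.filter fun l => i < l ∧ σ l < σ i ∧ σ i = i).card := by
    intro i hi
    have hi' := not_lt.1 (mem_filter.1 hi).2
    rw [nestAt, if_neg (mem_filter.1 hi).2, ← card_union_of_disjoint]
    · congr 1
      ext l
      have := hi'.lt_or_eq
      simp only [mem_filter, mem_univ, true_and, mem_union]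
      tauto
    · rw [disjoint_filter]
      rintro l - h1 h2
      exact h1.2.2.ne h2.2.2
  rw [sum_congr rfl hsplit, sum_add_distrib, ← card_sigma, ← card_sigma, psnest_eq_lpsnest,
    lnest, lpsnest]
  congr 1
  · refine card_bij' (fun b _ => (σ b.2, σ b.1, b.1, b.2)) (fun a _ => ⟨a.2.2.1, a.2.2.2⟩)
      ?_ ?_ ?_ ?_
    · rintro ⟨i, j⟩ h; simp at h ⊢; grind
    · rintro ⟨i, j, k, l⟩ h; simp at h ⊢; grind
    · rintro ⟨i, j⟩ h; simp
    · rintro ⟨i, j, k, l⟩ h; simp at h ⊢; grind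
  · refine card_bij' (fun b _ => (σ b.2, b.1, b.2)) (fun a _ => ⟨a.2.1, a.2.2⟩) ?_ ?_ ?_ ?_
    · rintro ⟨i, j⟩ h; simp at h ⊢; grind
    · rintro ⟨i, j, l⟩ h; simp at h ⊢; grind
    · rintro ⟨i, j⟩ h; simp
    · rintro ⟨i, j, l⟩ h; simp at h ⊢; grind

theorem nestAt_eq_zero_iff_isRecord {σ : Equiv.Perm (Fin n)} {i : Fin n} (hi : i < σ i) :
    nestAt σ i = 0 ↔ IsRecord σ i := by
  rw [nestAt, if_pos hi, card_eq_zero, filter_eq_empty_iff]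
  simp only [mem_univ, true_implies, not_and, not_lt, IsRecord]
  exact forall_congr' fun j => forall_congr' fun hj =>
    ⟨fun h => lt_of_le_of_ne h (σ.injective.ne hj.ne), le_of_lt⟩

theorem nestAt_eq_zero_iff_isAntirecord {σ : Equiv.Perm (Fin n)} {i : Fin n} (hi : ¬ i < σ i) :
    nestAt σ i = 0 ↔ IsAntirecord σ i := by
  rw [nestAt, if_neg hi, card_eq_zero, filter_eq_empty_iff]
  simp only [mem_univ, true_implies, not_and, not_lt, IsAntirecord]
  exact forall_congr' fun j => forall_congr' fun hj =>
    ⟨fun h => lt_of_le_of_ne h (σ.injective.ne hj.ne), le_of_lt⟩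

/-- The exclusive records are exactly the records that are excedances: an excedance is never an
antirecord, and a record that is a fixed point always is one. -/
theorem card_nestAt_eq_zero_upper (σ : Equiv.Perm (Fin n)) :
    (univ.filter fun i => i < σ i ∧ nestAt σ i = 0).card = erec σ := by
  rw [erec]
  congr 1
  ext i
  simp only [mem_filter, mem_univ, true_and]
  constructor
  · rintro ⟨h1, h2⟩
    exact ⟨(nestAt_eq_zero_iff_isRecord h1).1 h2, fun h => h.le.not_gt h1⟩
  · rintro ⟨h1, h2⟩
    have h3 : i < σ i := by
      refine lt_of_le_of_ne h1.le fun h => h2 fun j hj => ?_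
      by_contra hc
      -- Pigeonhole: if `i` is a fixed record and some later `j` had a smaller value, `σ` would
      -- inject `Iic i` together with `j` into `Iic i`.
      have hm : Set.MapsTo σ (insert j (Iic i) : Finset (Fin n)) (Iic i : Finset (Fin n)) := by
        intro k hk
        simp only [coe_insert, coe_Iic, Set.mem_insert_iff, Set.mem_Iic] at hk ⊢
        rcases hk with rfl | hk
        · exact (not_lt.1 hc).trans h.ge
        · rcases hk.lt_or_eq with h4 | rfl
          · exact (h1 k h4).le.trans h.ge
          · exact h.ge
      have := card_le_card_of_injOn σ hm σ.injective.injOn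
      rw [card_insert_of_notMem (by simpa using hj)] at this
      omega
    exact ⟨h3, (nestAt_eq_zero_iff_isRecord h3).2 h1⟩

theorem card_nestAt_ne_zero_upper (σ : Equiv.Perm (Fin n)) :
    (univ.filter fun i => i < σ i ∧ ¬ nestAt σ i = 0).card = exc σ - erec σ := by
  have h := card_filter_add_card_filter_not (s := univ.filter fun i => i < σ i)
    (fun i => nestAt σ i = 0)
  rw [filter_filter, filter_filter, card_nestAt_eq_zero_upper] at h
  rw [exc]
  omega

theorem card_nestAt_eq_zero_lower (σ : Equiv.Perm (Fin n)) :
    (univ.filter fun i => ¬ i < σ i ∧ nestAt σ i = 0).card = arec σ := by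
  rw [arec]
  congr 1
  ext i
  simp only [mem_filter, mem_univ, true_and]
  exact ⟨fun h => (nestAt_eq_zero_iff_isAntirecord h.1).1 h.2, fun h =>
    ⟨h.le.not_gt, (nestAt_eq_zero_iff_isAntirecord h.le.not_gt).2 h⟩⟩

theorem card_nestAt_ne_zero_lower (σ : Equiv.Perm (Fin n)) :
    (univ.filter fun i => ¬ i < σ i ∧ ¬ nestAt σ i = 0).card = n - exc σ - arec σ := by
  have h := card_filter_add_card_filter_not (s := univ.filter fun i => ¬ i < σ i)
    (fun i => nestAt σ i = 0)
  have h' := card_filter_add_card_filter_not (s := (univ : Finset (Fin n))) (fun i => i < σ i)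
  rw [filter_filter, filter_filter, card_nestAt_eq_zero_lower] at h
  rw [card_univ, Fintype.card_fin] at h'
  rw [exc]
  omega

section Weight

variable {R : Type*} [CommRing R]

/-- The weight of an arc: `b = 0` for upper arcs, with `r` nestings and `t` crossings. -/
def localWeight (x y u v pp pm qp qm : R) (b r t : ℕ) : R :=
  if b = 0 then qp ^ r * pp ^ t * (if r = 0 then y else v)
  else qm ^ r * pm ^ t * (if r = 0 then x else u)

theorem prod_pow_mul_ite {ι : Type*} (s : Finset ι) (A B : ι → ℕ) (q p a b : R) :
    ∏ i ∈ s, (q ^ A i * p ^ B i * (if A i = 0 then a else b)) =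
      q ^ (∑ i ∈ s, A i) * p ^ (∑ i ∈ s, B i) *
        (a ^ (s.filter fun i => A i = 0).card * b ^ (s.filter fun i => ¬ A i = 0).card) := by
  rw [prod_mul_distrib, prod_mul_distrib, prod_pow_eq_pow_sum, prod_pow_eq_pow_sum, prod_ite,
    prod_const, prod_const]

theorem prod_localWeight (x y u v pp pm qp qm : R) (σ : Equiv.Perm (Fin n)) :
    ∏ i, localWeight x y u v pp pm qp qm (if i < σ i then 0 else 1) (nestAt σ i) (crossAt σ i) =
    x ^ arec σ * y ^ erec σ * u ^ (n - exc σ - arec σ) * v ^ (exc σ - erec σ) *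
      (pp ^ ucross σ * pm ^ (lcross σ + ljoin σ) * qp ^ unest σ * qm ^ (lnest σ + psnest σ)) := by
  rw [← prod_filter_mul_prod_filter_not univ (fun i => i < σ i)]
  rw [prod_congr rfl (g := fun i => qp ^ nestAt σ i * pp ^ crossAt σ i *
      (if nestAt σ i = 0 then y else v)) (s₁ := univ.filter fun i => i < σ i)
      (fun i hi => by rw [if_pos (mem_filter.1 hi).2, localWeight, if_pos rfl]),
    prod_congr rfl (g := fun i => qm ^ nestAt σ i * pm ^ crossAt σ i *
      (if nestAt σ i = 0 then x else u)) (s₁ := univ.filter fun i => ¬ i < σ i)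
      (fun i hi => by rw [if_neg (mem_filter.1 hi).2, localWeight, if_neg one_ne_zero])]
  rw [prod_pow_mul_ite, prod_pow_mul_ite, sum_nestAt_upper, sum_nestAt_lower, sum_crossAt_upper,
    sum_crossAt_lower]
  simp only [filter_filter]
  rw [card_nestAt_eq_zero_upper, card_nestAt_ne_zero_upper, card_nestAt_eq_zero_lower,
    card_nestAt_ne_zero_lower]
  ring

end Weight

/-! ### Permutations as perfect parity matchings -/

/-- The arc of `σ` at position `i`, where position `i` is the point `2 * i + 1` and value `i` the
point `2 * i`. -/
def arc (σ : Equiv.Perm (Fin n)) (i : Fin n) : ℕ × ℕ :=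
  if i < σ i then (2 * (i : ℕ) + 1, 2 * (σ i : ℕ)) else (2 * (σ i : ℕ), 2 * (i : ℕ) + 1)

/-- The parity matching of a permutation. -/
def arcs (σ : Equiv.Perm (Fin n)) : Finset (ℕ × ℕ) := univ.image (arc σ)

theorem arc_cases (σ : Equiv.Perm (Fin n)) (i : Fin n) :
    ((i : ℕ) < σ i ∧ (arc σ i).1 = 2 * (i : ℕ) + 1 ∧ (arc σ i).2 = 2 * (σ i : ℕ)) ∨
    ((σ i : ℕ) ≤ i ∧ (arc σ i).1 = 2 * (σ i : ℕ) ∧ (arc σ i).2 = 2 * (i : ℕ) + 1) := by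
  rw [arc]
  split_ifs with h
  · exact Or.inl ⟨h, rfl, rfl⟩
  · exact Or.inr ⟨not_lt.1 h, rfl, rfl⟩

/-- A common odd point is a common position and a common even point a common value; in the second
case injectivity of `σ` applies. -/
theorem eq_of_arc_shared (σ : Equiv.Perm (Fin n)) {i j : Fin n}
    (h : (arc σ i).1 = (arc σ j).1 ∨ (arc σ i).1 = (arc σ j).2 ∨ (arc σ i).2 = (arc σ j).1 ∨
      (arc σ i).2 = (arc σ j).2) : i = j := by
  have h1 := arc_cases σ i
  have h2 := arc_cases σ j
  have h3 : (i : ℕ) = j ∨ (σ i : ℕ) = σ j := by omega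
  rcases h3 with h3 | h3
  · exact Fin.ext h3
  · exact σ.injective (Fin.ext h3)

theorem arc_injective (σ : Equiv.Perm (Fin n)) : Function.Injective (arc σ) :=
  fun i j h => eq_of_arc_shared σ (Or.inl (by rw [h]))

theorem isPartial_arcs (σ : Equiv.Perm (Fin n)) :
    ParityMatching.IsPartial (2 * n) (arcs σ) := by
  refine ⟨?_, ?_, ?_, ?_⟩
  · intro p hp
    obtain ⟨i, -, rfl⟩ := mem_image.1 hp
    have := arc_cases σ i; omega
  · intro p hp
    obtain ⟨i, -, rfl⟩ := mem_image.1 hp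
    have := arc_cases σ i; omega
  · intro p hp
    obtain ⟨i, -, rfl⟩ := mem_image.1 hp
    have := arc_cases σ i; omega
  · intro p hp q hq h
    obtain ⟨i, -, rfl⟩ := mem_image.1 hp
    obtain ⟨j, -, rfl⟩ := mem_image.1 hq
    rw [eq_of_arc_shared σ h]

theorem arcs_mem_partials (σ : Equiv.Perm (Fin n)) :
    arcs σ ∈ ParityMatching.partials (2 * n) n := by
  rw [ParityMatching.mem_partials, arcs, card_image_of_injective _ (arc_injective σ), card_univ,
    Fintype.card_fin]
  exact ⟨isPartial_arcs σ, rfl⟩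

theorem arcs_injective : Function.Injective (arcs (n := n)) := by
  intro σ τ h
  ext i
  have h1 : arc σ i ∈ arcs τ := h ▸ mem_image_of_mem _ (mem_univ i)
  obtain ⟨j, -, hj⟩ := mem_image.1 h1
  have h2 := arc_cases σ i
  have h3 := arc_cases τ j
  rw [hj] at h3
  obtain rfl : i = j := Fin.ext (by omega)
  omega

/-- With `n` arcs no odd point is left unmatched, so every position has an arc, and by parity its
other end is a value. Disjointness of the arcs makes this assignment injective, hence a permutation.
Its arcs lie in `M`, and the cardinalities agree. -/
theorem exists_arcs_eq {M : Finset (ℕ × ℕ)} (hM : M ∈ ParityMatching.partials (2 * n) n) :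
    ∃ σ : Equiv.Perm (Fin n), arcs σ = M := by
  obtain ⟨h, hm⟩ := ParityMatching.mem_partials.1 hM
  have hcov : ∀ i : Fin n, ∃ j : Fin n, (2 * (i : ℕ) + 1, 2 * (j : ℕ)) ∈ M ∨
      (2 * (j : ℕ), 2 * (i : ℕ) + 1) ∈ M := by
    intro i
    have h1 := ParityMatching.card_opens_add h (r := 1) (by omega)
    rw [(ParityMatching.card_filter_range_mod_two _).2] at h1
    have h2 : ParityMatching.opens M (2 * n) 1 = ∅ := card_eq_zero.1 (by omega)
    have h3 : 2 * (i : ℕ) + 1 ∉ ParityMatching.opens M (2 * n) 1 := by rw [h2]; exact notMem_empty _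
    simp only [ParityMatching.opens, mem_filter, mem_range] at h3
    have h4 : ∃ p ∈ M, p.1 = 2 * (i : ℕ) + 1 ∨ p.2 = 2 * (i : ℕ) + 1 := by
      by_contra hc
      push Not at hc
      exact h3 ⟨by omega, by omega, fun p hp _ => hc p hp⟩
    obtain ⟨⟨a, b⟩, hp, hi⟩ := h4
    have h5 := h.lt _ hp
    have h6 := h.lt_bound _ hp
    have h7 := h.parity _ hp
    dsimp only at h5 h6 h7 hi
    rcases hi with rfl | rfl
    · refine ⟨⟨b / 2, by omega⟩, Or.inl ?_⟩
      rwa [show 2 * (b / 2) = b by omega]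
    · refine ⟨⟨a / 2, by omega⟩, Or.inr ?_⟩
      rwa [show 2 * (a / 2) = a by omega]
  choose f hf using hcov
  have hinj : Function.Injective f := by
    intro i j hij
    have hi := hf i
    have hj := hf j
    rw [hij] at hi
    have key : ∀ p ∈ M, ∀ q ∈ M, (p.1 = q.1 ∨ p.1 = q.2 ∨ p.2 = q.1 ∨ p.2 = q.2) →
        p.1 = q.1 ∧ p.2 = q.2 := fun p hp q hq e => by
      rw [h.eq_of_shared p hp q hq e]; exact ⟨rfl, rfl⟩
    refine Fin.ext ?_
    rcases hi with hi | hi <;> rcases hj with hj | hj <;>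
    · have := key _ hi _ hj (by simp)
      dsimp only at this
      omega
  refine ⟨Equiv.ofBijective f (Finite.injective_iff_bijective.1 hinj), ?_⟩
  set σ := Equiv.ofBijective f (Finite.injective_iff_bijective.1 hinj) with hσ
  refine eq_of_subset_of_card_le ?_ ?_
  · intro p hp
    obtain ⟨i, -, rfl⟩ := mem_image.1 hp
    have hi : σ i = f i := rfl
    rw [arc, hi]
    rcases hf i with h1 | h1
    · have := h.lt _ h1
      rwa [if_pos (Fin.lt_def.2 (by dsimp only at this; omega))]
    · have := h.lt _ h1
      rwa [if_neg (fun hc => by have := Fin.lt_def.1 hc; dsimp only at *; omega)]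
  · rw [hm, (ParityMatching.mem_partials.1 (arcs_mem_partials σ)).2]

theorem mem_partners_arcs {σ : Equiv.Perm (Fin n)} {b c : ℕ} :
    c ∈ ParityMatching.partners (arcs σ) b ↔ c < b ∧ c % 2 = (b + 1) % 2 ∧
      ∀ j, (arc σ j).2 < b → (arc σ j).1 ≠ c ∧ (arc σ j).2 ≠ c := by
  simp [ParityMatching.mem_partners, arcs]

/-- A position `j` before the value point `2 * (σ i)` is still open there exactly when its own value
is not smaller than `σ i`; otherwise its arc has already closed. -/
theorem partners_arcs_upper (σ : Equiv.Perm (Fin n)) (i : Fin n) :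
    ParityMatching.partners (arcs σ) (2 * (σ i : ℕ)) =
      (univ.filter fun j => j < σ i ∧ σ i ≤ σ j).image fun j : Fin n => 2 * (j : ℕ) + 1 := by
  ext c
  simp only [mem_partners_arcs, mem_image, mem_filter, mem_univ, true_and, Fin.lt_def, Fin.le_def]
  constructor
  · rintro ⟨h1, h2, h3⟩
    have hlt : c / 2 < n := by omega
    have h4 := h3 ⟨c / 2, hlt⟩
    have h5 := arc_cases σ ⟨c / 2, hlt⟩
    dsimp only at h4 h5
    exact ⟨⟨c / 2, hlt⟩, ⟨by dsimp only; omega, by omega⟩, by dsimp only; omega⟩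
  · rintro ⟨j, ⟨h1, h2⟩, rfl⟩
    refine ⟨by omega, by omega, fun k hk => ?_⟩
    have h5 := arc_cases σ k
    have h6 : (k : ℕ) = j → (σ k : ℕ) = σ j := fun h => by rw [Fin.ext h]
    omega

/-- Here the candidates are value points, indexed by the position `l` holding the value. The bound
`σ l ≤ i` is not strict because value `i` precedes position `i`, which makes fixed points and
joinings count with the lower arcs. -/
theorem partners_arcs_lower (σ : Equiv.Perm (Fin n)) (i : Fin n) :
    ParityMatching.partners (arcs σ) (2 * (i : ℕ) + 1) =
      (univ.filter fun l => σ l ≤ i ∧ i ≤ l).image fun l : Fin n => 2 * (σ l : ℕ) := by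
  ext c
  simp only [mem_partners_arcs, mem_image, mem_filter, mem_univ, true_and, Fin.le_def]
  constructor
  · rintro ⟨h1, h2, h3⟩
    have hlt : c / 2 < n := by omega
    obtain ⟨l, hl⟩ := σ.surjective ⟨c / 2, hlt⟩
    have hl' : (σ l : ℕ) = c / 2 := by rw [hl]
    have h4 := h3 l
    have h5 := arc_cases σ l
    exact ⟨l, ⟨by omega, by omega⟩, by omega⟩
  · rintro ⟨j, ⟨h1, h2⟩, rfl⟩
    refine ⟨by omega, by omega, fun k hk => ?_⟩
    have h5 := arc_cases σ k
    have h6 : (σ k : ℕ) = σ j → (k : ℕ) = j := fun h => by rw [σ.injective (Fin.ext h)]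
    omega

section Weight

/-- Among the arcs open when the arc of `i` closes, those opened before it nest over it and those
opened after it cross or join it. -/
theorem arcWeight_arcs {R : Type*} (w : ℕ → ℕ → ℕ → R) (σ : Equiv.Perm (Fin n)) (i : Fin n) :
    ParityMatching.arcWeight w (arcs σ) (arc σ i) =
      w (if i < σ i then 0 else 1) (nestAt σ i) (crossAt σ i) := by
  have hval : ∀ j k : Fin n, (σ j : ℕ) = σ k → (j : ℕ) = k := fun j k h => by
    rw [σ.injective (Fin.ext h)]
  rw [ParityMatching.arcWeight, nestAt, crossAt, arc]
  split_ifs with h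
  · have hinj : Function.Injective fun j : Fin n => 2 * (j : ℕ) + 1 := fun j k e => by
      refine Fin.ext ?_; dsimp only at e; omega
    dsimp only
    rw [partners_arcs_upper, filter_image, filter_image, card_image_of_injective _ hinj,
      card_image_of_injective _ hinj, filter_filter, filter_filter, Nat.mul_mod_right]
    rw [Fin.lt_def] at h
    -- The partners include the opener of the arc itself. Once it is excluded by a strict
    -- comparison, injectivity of `σ` turns the remaining weak inequality into the strict one of
    -- `nestAt` or `crossAt`.
    congr 2 <;>
    · ext j
      have h1 := hval j i
      have h2 : (j : ℕ) = i → (σ j : ℕ) = σ i := fun e => by rw [Fin.ext e]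
      simp only [mem_filter, mem_univ, true_and, Fin.lt_def, Fin.le_def]
      omega
  · have hinj : Function.Injective fun j : Fin n => 2 * (σ j : ℕ) := fun j k e => by
      refine σ.injective (Fin.ext ?_); dsimp only at e; omega
    dsimp only
    rw [partners_arcs_lower, filter_image, filter_image, card_image_of_injective _ hinj,
      card_image_of_injective _ hinj, filter_filter, filter_filter, Nat.mul_add_mod]
    rw [Fin.lt_def] at h
    congr 2 <;>
    · ext j
      have h1 := hval j i
      have h2 : (j : ℕ) = i → (σ j : ℕ) = σ i := fun e => by rw [Fin.ext e]
      simp only [mem_filter, mem_univ, true_and, Fin.lt_def, Fin.le_def]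
      omega

variable {R : Type*} [CommRing R]

theorem P_eq_total (n : ℕ) (x y u v pp pm qp qm : R) : P n x y u v pp pm qp qm =
    ParityMatching.total (localWeight x y u v pp pm qp qm) (2 * n) n := by
  rw [P, ParityMatching.total]
  refine sum_bij (fun σ _ => arcs σ) (fun σ _ => arcs_mem_partials σ)
    (fun σ _ τ _ h => arcs_injective h) (fun M hM => ?_) (fun σ _ => ?_)
  · obtain ⟨σ, h⟩ := exists_arcs_eq hM
    exact ⟨σ, mem_univ _, h⟩
  · rw [ParityMatching.weight, arcs, prod_image (arc_injective σ).injOn, ← prod_localWeight]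
    exact prod_congr rfl fun i _ => (arcWeight_arcs _ σ i).symm

/-- Rank `0` gives the term in `a`. The other ranks share a factor `q`, and reversing their order
yields the summands of `pqInt`. -/
theorem sum_pow_mul_ite (p q a b : R) (k : ℕ) :
    ∑ r ∈ range (k + 1), q ^ r * p ^ (k - r) * (if r = 0 then a else b) =
      p ^ k * a + q * pqInt k p q * b := by
  rw [sum_range_succ', add_comm, pqInt, ← sum_range_reflect, mul_sum, sum_mul]
  congr 1
  · simp
  · refine sum_congr rfl fun j hj => ?_
    have hj := mem_range.1 hj
    rw [if_neg (Nat.succ_ne_zero _), show k - (k - 1 - j + 1) = j by omega]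
    ring

end Weight

end PermStat

theorem theorem2p8 {R : Type*} [CommRing R] (x y u v pp pm qp qm : R) (α : ℕ → R)
    (hodd : ∀ k : ℕ, 1 ≤ k →
      α (2 * k - 1) = pm ^ (k - 1) * x + qm * PermStat.pqInt (k - 1) pm qm * u)
    (heven : ∀ k : ℕ, 1 ≤ k →
      α (2 * k) = pp ^ (k - 1) * y + qp * PermStat.pqInt (k - 1) pp qp * v) :
    PowerSeries.mk (fun n => PermStat.P n x y u v pp pm qp qm) = SFrac.sFraction α := by
  ext n
  rw [PowerSeries.coeff_mk, PermStat.P_eq_total]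
  -- Falls from odd heights occur at odd points, which close the arcs of non-excedances, so odd
  -- indices carry `x, u, pm, qm`; even indices carry the excedance weights. The index `k` here is
  -- one less than in `hodd` and `heven`.
  refine ParityMatching.total_eq_coeff_sFraction _ α (fun k => ?_) (fun k => ?_) n
  · simp only [PermStat.localWeight, if_neg one_ne_zero]
    rw [PermStat.sum_pow_mul_ite]
    exact hodd (k + 1) (by omega)
  · simp only [PermStat.localWeight, if_true]
    rw [PermStat.sum_pow_mul_ite]
    exact heven (k + 1) (by omega)
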